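/- Let $\mathfrak p$ be the pseudo-intersection number, i.e. the least cardinality of a family $\mathcal F\subset\mathcal P(\mathbb N)$ such that every finite subfamily of $\mathcal F$ has infinite intersection, but there is no infinite $P\subset\mathbb N$ with $P\setminus F$ finite for all $F\in\mathcal F$. Let $2^{\omega_1}=\{0,1\}^{\omega_1}$ be the Cantor cube with the product topology, and let $C(2^{\omega_1})$ be the Banach space of continuous real-valued functions on $2^{\omega_1}$ with the supremum norm. Assume $\mathfrak p>\omega_1$. Then the Borel $\sigma$-algebra $\mathrm{Bo}(C(2^{\omega_1}))$ of the norm topology is countably generated. More precisely, $2^{\omega_1}$ has a countable dense subset, and for every countable dense set $A\subset 2^{\omega_1}$, $\mathrm{Bo}(C(2^{\omega_1}))$ is the $\sigma$-algebra generated by the evaluations $f\mapsto f(a)$, $a\in A$. -/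

import Mathlib

open Set Cardinal Ordinal

/-- A family of sets of natural numbers has the strong finite intersection property if the
intersection of every finite subfamily is infinite. -/
def HasSFIP (F : Set (Set ℕ)) : Prop :=
  ∀ G : Set (Set ℕ), G ⊆ F → G.Finite → (⋂₀ G).Infinite

/-- `P` is a pseudo-intersection of `F` if `P` is almost contained in every member of `F`. -/
def IsPseudoIntersection (P : Set ℕ) (F : Set (Set ℕ)) : Prop :=
  ∀ A ∈ F, (P \ A).Finite

/-- The pseudo-intersection number `𝔭`: the least cardinality of a family of sets of natural
numbers which has the strong finite intersection property but no infinite pseudo-intersection. -/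
noncomputable def pseudoIntersectionNumber : Cardinal.{0} :=
  sInf {κ : Cardinal.{0} | ∃ F : Set (Set ℕ), #F = κ ∧ HasSFIP F ∧
    ¬ ∃ P : Set ℕ, P.Infinite ∧ IsPseudoIntersection P F}

/-- The Cantor cube `2^Γ` with the product topology of the discrete two-point space. -/
abbrev CantorCube (Γ : Type*) : Type _ := Γ → Bool

/-- The σ-algebra on `C(K, ℝ)` generated by the evaluations `f ↦ f a`, `a ∈ A`: the smallest one
for which all of them are measurable. -/
abbrev evalSigmaAlgebra {K : Type*} [TopologicalSpace K] (A : Set K) : MeasurableSpace C(K, ℝ) :=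
  ⨆ a ∈ A, MeasurableSpace.comap (fun f : C(K, ℝ) => f a) (borel ℝ)

/-!
Fix an infinite `Γ` with `#Γ < 𝔭` and a countable dense `A ⊆ 2^Γ`. Evaluations are norm continuous,
so the evaluations at `A` generate a σ-algebra contained in the Borel one. Conversely, each point
of `2^Γ` has fewer than `𝔭` basic neighbourhoods and each of them meets `A` in an infinite set; a
pseudo-intersection of these traces is a sequence in `A` converging to the point
(`exists_seq_tendsto_of_dense`). Hence every evaluation is measurable for the σ-algebra generated
by the evaluations at `A`, and it remains to show that norm open sets belong to the σ-algebra
generated by all evaluations.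

Rational polynomials in the coordinates are dense in `C(2^Γ)`, so an open `U` is a union of balls
around such polynomials, but there may be uncountably many. To reduce to countably many sets, embed
`Γ` into `𝒫(ℕ)`; truncation gives maps `e n : Γ → Δ` into a countable set which eventually separate
any finite subset of `Γ`. The `n`-th code of a polynomial `p` records `n` and the images of `p` and
its variables under `e n`. Each of the countably many codes `c` determines a measurable set of
functions (`measurableSet_codeSet`): those within `ε` of the polynomial of `c` at all points that
are constant on the relevant fibres of `e n`. It contains the `ε`-ball of every polynomial with
code `c` (`mem_codeSet_code`). Conversely, `f` depends up to `ε` on a finite set `F` of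
coordinates, and if `f` is in the set of the `n`-th code of `p`, where `e n` is injective on `F`
and the variables of `p`, then `f` is within `2ε` of `p` (`abs_sub_polyFun_le`).

Let `T` be the set of polynomials whose `3ε`-ball lies in `U`. The second use of `#Γ < 𝔭` is a set
`S` of codes with infinitely many codes of each `p ∈ T` and such that, for each finite `F`, almost
every member of `S` is the code of some `p ∈ T` at a level separating `F` and the variables of `p`
(`exists_infinite_inter_and_almost_subset`). The functions lying in the sets of infinitely many
codes from `S` then form a measurable subset of `U`, which contains every point that is the centre
of a ball of radius `4ε` inside `U`; the union over `ε = 1/(k+1)` is `U`.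
-/

open Filter Topology MeasureTheory

universe u

/-! ### Pseudo-intersections and the selection lemma -/

/-- The defining property of `𝔭`, for indexed families of subsets of an arbitrary countable
infinite type. -/
theorem exists_infinite_pseudoIntersection {Q : Type*} [Countable Q] [Infinite Q] {ι : Type u}
    (hι : #ι < lift.{u} pseudoIntersectionNumber) (A : ι → Set Q)
    (hA : ∀ t : Finset ι, (⋂ i ∈ t, A i).Infinite) :
    ∃ P : Set Q, P.Infinite ∧ ∀ i, (P \ A i).Finite := by
  classical
  obtain ⟨e⟩ : Nonempty (Q ≃ ℕ) := nonempty_equiv_of_countable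
  set F : Set (Set ℕ) := range fun i => e '' A i with hF
  have hsfip : HasSFIP F := by
    intro G hG hGfin
    obtain ⟨t, ht⟩ := Set.subset_range_iff_exists_image_eq.1 (hF ▸ hG)
    obtain ⟨t', ht', htG⟩ := Set.exists_subset_bijOn t fun i => e '' A i
    have ht'fin : t'.Finite := by
      refine Set.Finite.of_finite_image ?_ htG.injOn
      rw [htG.image_eq, ht]
      exact hGfin
    refine ((hA ht'fin.toFinset).image e.injective.injOn).mono ?_
    rintro _ ⟨q, hq, rfl⟩ B hB
    rw [← ht, ← htG.image_eq] at hB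
    obtain ⟨i, hi, rfl⟩ := hB
    simp only [Set.Finite.mem_toFinset, mem_iInter] at hq
    exact mem_image_of_mem _ (hq i hi)
  have hcard : #F < pseudoIntersectionNumber := by
    have h1 : lift.{u} #F ≤ lift.{0} #ι := mk_range_le_lift
    rw [Cardinal.lift_uzero] at h1
    exact Cardinal.lift_lt.1 (h1.trans_lt hι)
  by_contra hcon
  refine hcard.not_ge (csInf_le' ⟨F, rfl, hsfip, ?_⟩)
  rintro ⟨P, hP, hPF⟩
  refine hcon ⟨e ⁻¹' P, hP.preimage (by simp), fun i => ?_⟩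
  refine Set.Finite.of_finite_image ((hPF _ (mem_range_self i)).subset ?_)
    (f := e) e.injective.injOn
  rintro _ ⟨q, hq, rfl⟩
  exact ⟨hq.1, fun ⟨q', hq', h⟩ => hq.2 (e.injective h ▸ hq')⟩

/-- If `𝔭` is positive, its defining infimum is not the junk value of an empty set, so `𝔭` is the
cardinality of a set of sets of natural numbers. -/
theorem exists_family_of_pos_pseudoIntersectionNumber (h : 0 < pseudoIntersectionNumber) :
    ∃ F : Set (Set ℕ), #F = pseudoIntersectionNumber := by
  have hne : {κ : Cardinal.{0} | ∃ F : Set (Set ℕ), #F = κ ∧ HasSFIP F ∧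
      ¬ ∃ P : Set ℕ, P.Infinite ∧ IsPseudoIntersection P F}.Nonempty := by
    by_contra hcon
    rw [Set.not_nonempty_iff_eq_empty] at hcon
    rw [pseudoIntersectionNumber, hcon, Cardinal.sInf_empty] at h
    exact lt_irrefl _ h
  obtain ⟨F, hF, -⟩ := csInf_mem hne
  exact ⟨F, hF⟩

theorem exists_injective_of_mk_lt {Γ : Type u}
    (hΓ : #Γ < lift.{u} pseudoIntersectionNumber) :
    ∃ r : Γ → Set ℕ, Function.Injective r := by
  have hpos : 0 < pseudoIntersectionNumber := by
    refine pos_iff_ne_zero.2 fun h => ?_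
    rw [h, Cardinal.lift_zero] at hΓ
    exact not_lt_zero hΓ
  obtain ⟨F, hF⟩ := exists_family_of_pos_pseudoIntersectionNumber hpos
  have h : lift.{0} #Γ ≤ lift.{u} #F := by
    rw [Cardinal.lift_uzero, hF]
    exact hΓ.le
  obtain ⟨f⟩ := lift_mk_le'.1 h
  exact ⟨fun γ => f γ, Subtype.val_injective.comp f.injective⟩

theorem Finset.infinite_of_forall_exists_le_card {Q : Type*} {X : Set (Finset Q)}
    (h : ∀ n : ℕ, ∃ s ∈ X, n ≤ s.card) : X.Infinite := by
  refine Set.Infinite.of_image Finset.card (Set.infinite_of_forall_exists_gt fun n => ?_)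
  obtain ⟨s, hs, hn⟩ := h (n + 1)
  exact ⟨_, Set.mem_image_of_mem _ hs, hn⟩

/-- Fewer than `𝔭` infinite sets `A i` and fewer than `𝔭` sets `G j`, each `A i` being almost
contained in each `G j`, admit one set `S` which meets every `A i` in an infinite set and is almost
contained in every `G j`. The set `S` is the union of a pseudo-intersection of families of finite
sets. -/
theorem exists_infinite_inter_and_almost_subset {Q : Type*} [Countable Q] {I J : Type u}
    (hinf : ℵ₀ < lift.{u} pseudoIntersectionNumber)
    (hI : #I < lift.{u} pseudoIntersectionNumber) (hJ : #J < lift.{u} pseudoIntersectionNumber)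
    (A : I → Set Q) (G : J → Set Q) (hA : ∀ i, (A i).Infinite)
    (hAG : ∀ i j, (A i \ G j).Finite) :
    ∃ S : Set Q, (∀ i, (S ∩ A i).Infinite) ∧ ∀ j, (S \ G j).Finite := by
  classical
  cases isEmpty_or_nonempty I with
  | inl hIe => exact ⟨∅, fun i => hIe.elim i, fun j => by simp⟩
  | inr hIn =>
  obtain ⟨i₀⟩ := hIn
  have : Infinite Q := Set.infinite_univ_iff.1 ((hA i₀).mono (subset_univ _))
  let 𝓕 : (I × ℕ) ⊕ J → Set (Finset Q) := Sum.elim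
    (fun p => {s | ∃ t ⊆ s, (t : Set Q) ⊆ A p.1 ∧ p.2 ≤ t.card}) (fun j => {s | (s : Set Q) ⊆ G j})
  have hcard : #((I × ℕ) ⊕ J) < lift.{u} pseudoIntersectionNumber := by
    rw [mk_sum, Cardinal.lift_id, Cardinal.lift_id]
    refine add_lt_of_lt hinf.le ?_ hJ
    rw [mk_prod, Cardinal.lift_uzero, mk_nat, lift_aleph0]
    exact mul_lt_of_lt hinf.le hI hinf
  obtain ⟨P, hP, hPF⟩ := exists_infinite_pseudoIntersection hcard 𝓕 (by
    intro t
    refine Finset.infinite_of_forall_exists_le_card fun n => ?_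
    -- `i₀` is added so that `s` can be made large even if `t` holds no condition on its size
    let I₀ : Finset I := insert i₀ (t.toLeft.image Prod.fst)
    let N : ℕ := n + t.toLeft.sup Prod.snd
    have hB : ∀ i, ((A i) \ ⋃ j ∈ t.toRight, (A i \ G j)).Infinite := fun i =>
      (hA i).sdiff (t.toRight.finite_toSet.biUnion fun j _ => hAG i j)
    choose T hTsub hTcard using fun i => (hB i).exists_subset_card_eq N
    refine ⟨I₀.biUnion T, ?_, ?_⟩
    · simp only [mem_iInter]
      rintro (⟨i, m⟩ | j) h
      · refine ⟨T i, Finset.subset_biUnion_of_mem T ?_, (hTsub i).trans sdiff_subset, ?_⟩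
        · exact Finset.mem_insert_of_mem
            (Finset.mem_image.2 ⟨(i, m), Finset.mem_toLeft.2 h, rfl⟩)
        · rw [hTcard]
          exact (Finset.le_sup (f := Prod.snd) (Finset.mem_toLeft.2 h)).trans
            (Nat.le_add_left _ _)
      · intro q hq
        obtain ⟨i, -, hq⟩ := Finset.mem_biUnion.1 (Finset.mem_coe.1 hq)
        have h1 := hTsub i (Finset.mem_coe.2 hq)
        by_contra hqG
        exact h1.2 (mem_biUnion (Finset.mem_coe.2 (Finset.mem_toRight.2 h)) ⟨h1.1, hqG⟩)
    · calc n ≤ N := Nat.le_add_right _ _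
        _ = (T i₀).card := (hTcard i₀).symm
        _ ≤ _ := Finset.card_le_card
          (Finset.subset_biUnion_of_mem T (Finset.mem_insert_self _ _)))
  refine ⟨⋃ s ∈ P, (s : Set Q), fun i => ?_, fun j => ?_⟩
  · intro hfin
    obtain ⟨s, hs, hs'⟩ := (hP.sdiff (hPF (Sum.inl (i, hfin.toFinset.card + 1)))).nonempty
    simp only [Set.mem_sdiff, not_and, not_not] at hs'
    obtain ⟨t, hts, htA, hcard⟩ := hs' hs
    refine absurd (Finset.card_le_card (s := t) (t := hfin.toFinset) fun q hq => ?_) (by omega)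
    rw [Set.Finite.mem_toFinset]
    exact ⟨mem_biUnion hs (hts hq), htA hq⟩
  · refine ((hPF (Sum.inr j)).biUnion fun s _ => s.finite_toSet).subset ?_
    rintro q ⟨hq, hqG⟩
    obtain ⟨s, hs, hqs⟩ := mem_iUnion₂.1 hq
    exact mem_biUnion ⟨hs, fun h => hqG (h hqs)⟩ hqs

/-! ### Convergent sequences in a countable dense set, and evaluations -/

theorem infinite_setOf_agree {Γ : Type*} [Infinite Γ] (x : CantorCube Γ) (F : Finset Γ) :
    {y : CantorCube Γ | ∀ β ∈ F, y β = x β}.Infinite := by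
  classical
  refine ((F.finite_toSet.infinite_compl).image
    (f := fun γ => Function.update x γ (!x γ)) ?_).mono ?_
  · intro γ _ γ' _ h
    by_contra hne
    have := congrFun h γ
    simp [Function.update_of_ne hne] at this
  · rintro _ ⟨γ, hγ, rfl⟩ β hβ
    refine Function.update_of_ne ?_ _ _
    rintro rfl
    exact hγ hβ

theorem isOpen_setOf_agree {Γ : Type*} (x : CantorCube Γ) (F : Finset Γ) :
    IsOpen {y : CantorCube Γ | ∀ β ∈ F, y β = x β} := by
  have : {y : CantorCube Γ | ∀ β ∈ F, y β = x β} = (F : Set Γ).pi fun β => {x β} := by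
    ext y; simp [Set.mem_pi]
  rw [this]
  exact isOpen_set_pi F.finite_toSet fun _ _ => isOpen_discrete _

/-- If `2^Γ` has weight less than `𝔭`, then every point is the limit of a sequence from any
given countable dense set. -/
theorem exists_seq_tendsto_of_dense {Γ : Type u} [Infinite Γ]
    (hΓ : #Γ < lift.{u} pseudoIntersectionNumber) {A : Set (CantorCube Γ)} (hA : A.Countable)
    (hd : Dense A) (x : CantorCube Γ) :
    ∃ a : ℕ → CantorCube Γ, (∀ n, a n ∈ A) ∧ Tendsto a atTop (𝓝 x) := by
  have hinf : ∀ F : Finset Γ, (A ∩ {y | ∀ β ∈ F, y β = x β}).Infinite := by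
    intro F hfin
    refine infinite_setOf_agree x F (hfin.subset ?_)
    rw [inter_comm]
    refine (hd.open_subset_closure_inter (isOpen_setOf_agree x F)).trans ?_
    rw [inter_comm, hfin.isClosed.closure_eq]
  have : Countable A := hA.to_subtype
  have : Infinite A := by
    rw [infinite_coe_iff]
    exact (hinf ∅).mono inter_subset_left
  obtain ⟨P, hP, hPx⟩ := exists_infinite_pseudoIntersection hΓ
    (fun γ => {a : A | a.1 γ = x γ}) (by
      intro F
      refine Set.Infinite.of_image Subtype.val ((hinf F).mono ?_)
      rintro y ⟨hy, hyF⟩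
      exact ⟨⟨y, hy⟩, by simpa using hyF, rfl⟩)
  let e := hP.natEmbedding
  refine ⟨fun n => (e n).1.1, fun n => (e n).1.2, tendsto_pi_nhds.2 fun γ => ?_⟩
  refine tendsto_nhds_of_eventually_eq ?_
  have h1 : Function.Injective fun n => (e n).1 := Subtype.val_injective.comp e.injective
  have h2 := (h1.tendsto_cofinite).eventually (hPx γ).eventually_cofinite_notMem
  rw [Nat.cofinite_eq_atTop] at h2
  filter_upwards [h2] with n hn
  by_contra hne
  exact hn ⟨(e n).2, hne⟩

theorem measurable_eval_of_mem {K : Type*} [TopologicalSpace K] {A : Set K} {a : K} (ha : a ∈ A) :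
    Measurable[evalSigmaAlgebra A] fun f : C(K, ℝ) => f a := by
  have h : MeasurableSpace.comap (fun f : C(K, ℝ) => f a) (borel ℝ) ≤ evalSigmaAlgebra A :=
    le_iSup₂_of_le a ha le_rfl
  rw [measurable_iff_comap_le, BorelSpace.measurable_eq (α := ℝ)]
  exact h

theorem measurable_eval {Γ : Type u} [Infinite Γ]
    (hΓ : #Γ < lift.{u} pseudoIntersectionNumber) {A : Set (CantorCube Γ)} (hA : A.Countable)
    (hd : Dense A) (x : CantorCube Γ) :
    Measurable[evalSigmaAlgebra A] fun f : C(CantorCube Γ, ℝ) => f x := by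
  obtain ⟨a, haA, ha⟩ := exists_seq_tendsto_of_dense hΓ hA hd x
  refine @measurable_of_tendsto_metrizable _ _ (evalSigmaAlgebra A) _ _ _ _
    (fun n f => f (a n)) _ (fun n => measurable_eval_of_mem (haA n)) ?_
  exact tendsto_pi_nhds.2 fun f => (f.continuous.tendsto x).comp ha

theorem evalSigmaAlgebra_le_borel {K : Type*} [TopologicalSpace K] (A : Set K) :
    evalSigmaAlgebra A ≤ borel C(K, ℝ) := by
  refine iSup₂_le fun a _ => ?_
  borelize C(K, ℝ)
  have h : Measurable fun f : C(K, ℝ) => f a :=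
    (continuous_eval_const a).measurable
  rw [measurable_iff_comap_le, BorelSpace.measurable_eq (α := ℝ),
    BorelSpace.measurable_eq (α := C(K, ℝ))] at h
  exact h

theorem countablyGenerated_evalSigmaAlgebra {K : Type*} [TopologicalSpace K] {A : Set K}
    (hA : A.Countable) : @MeasurableSpace.CountablyGenerated C(K, ℝ) (evalSigmaAlgebra A) := by
  have : Countable A := hA.to_subtype
  choose b hb hb' using fun a : A =>
    (MeasurableSpace.CountablyGenerated.comap (m := borel ℝ)
      (h := BorelSpace.measurable_eq (α := ℝ) ▸ inferInstance)
      (fun f : C(K, ℝ) => f a)).isCountablyGenerated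
  refine @MeasurableSpace.CountablyGenerated.mk _ (evalSigmaAlgebra A)
    ⟨⋃ a, b a, countable_iUnion hb, ?_⟩
  rw [evalSigmaAlgebra, iSup_subtype', ← MeasurableSpace.iSup_generateFrom]
  exact iSup_congr hb'

/-! ### Density of rational polynomials in the coordinates -/

/-- The coordinate function of `2^Γ` at `γ`, with values `0` and `1`. -/
def CantorCube.coord {Γ : Type*} (γ : Γ) : C(CantorCube Γ, ℝ) where
  toFun x := bif x γ then 1 else 0
  continuous_toFun :=
    (continuous_of_discreteTopology (f := fun b : Bool => bif b then (1 : ℝ) else 0)).comp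
      (continuous_apply γ)

/-- The continuous function on `2^Γ` given by a rational polynomial in the coordinates. -/
noncomputable def CantorCube.polyFun {Γ : Type*} (p : MvPolynomial Γ ℚ) : C(CantorCube Γ, ℝ) :=
  MvPolynomial.aeval CantorCube.coord p

namespace CantorCube

theorem polyFun_apply {Γ : Type*} (p : MvPolynomial Γ ℚ) (x : CantorCube Γ) :
    polyFun p x = MvPolynomial.aeval (fun γ => bif x γ then (1 : ℝ) else 0) p := by
  induction p using MvPolynomial.induction_on with
  | C a => simp [polyFun]
  | add p q hp hq => simp_all [polyFun]
  | mul_X p γ hp => simp_all [polyFun, coord]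

theorem polyFun_congr {Γ : Type*} {p : MvPolynomial Γ ℚ} {x y : CantorCube Γ}
    (h : ∀ γ ∈ p.vars, x γ = y γ) : polyFun p x = polyFun p y := by
  rw [polyFun_apply, polyFun_apply]
  exact MvPolynomial.eval₂Hom_congr' rfl (fun γ hγ _ => by rw [h γ hγ]) rfl

theorem polyFun_rename {Γ Δ : Type*} (e : Γ → Δ) (p : MvPolynomial Γ ℚ) (y : CantorCube Δ) :
    polyFun (MvPolynomial.rename e p) y = polyFun p (y ∘ e) := by
  rw [polyFun_apply, polyFun_apply, MvPolynomial.aeval_rename]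
  rfl

theorem denseRange_polyFun {Γ : Type*} :
    DenseRange (polyFun : MvPolynomial Γ ℚ → C(CantorCube Γ, ℝ)) := by
  let S : Subalgebra ℚ C(CantorCube Γ, ℝ) := (MvPolynomial.aeval (R := ℚ) (coord (Γ := Γ))).range
  have hconst : ∀ r : ℝ, algebraMap ℝ C(CantorCube Γ, ℝ) r ∈ S.topologicalClosure := by
    intro r
    have hcont : Continuous (algebraMap ℝ C(CantorCube Γ, ℝ)) := continuous_algebraMap _ _
    refine map_mem_closure hcont (Rat.denseRange_cast (𝕜 := ℝ) r) ?_
    rintro _ ⟨q, rfl⟩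
    have : algebraMap ℝ C(CantorCube Γ, ℝ) (q : ℝ) = algebraMap ℚ C(CantorCube Γ, ℝ) q := by
      ext x
      simp
    rw [this]
    exact S.algebraMap_mem q
  -- the closure of a rational subalgebra is closed under multiplication by real scalars
  let S' : Subalgebra ℝ C(CantorCube Γ, ℝ) :=
    { S.topologicalClosure.toSubsemiring with algebraMap_mem' := hconst }
  have hsep : S'.SeparatesPoints := by
    intro x y hxy
    obtain ⟨γ, hγ⟩ := Function.ne_iff.1 hxy
    refine ⟨coord γ, ⟨coord γ, S.le_topologicalClosure ⟨MvPolynomial.X γ, by simp⟩, rfl⟩, ?_⟩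
    cases hx : x γ <;> cases hy : y γ <;> simp_all [coord]
  have htop := ContinuousMap.subalgebra_topologicalClosure_eq_top_of_separatesPoints S' hsep
  intro f
  have hf : f ∈ closure (S' : Set C(CantorCube Γ, ℝ)) := by
    rw [← Subalgebra.topologicalClosure_coe, htop]
    trivial
  have hcl : (S' : Set C(CantorCube Γ, ℝ)) = closure (range polyFun) := rfl
  rwa [hcl, closure_closure] at hf

theorem exists_abs_sub_polyFun_lt {Γ : Type*} (f : C(CantorCube Γ, ℝ)) {ε : ℝ} (hε : 0 < ε) :
    ∃ p : MvPolynomial Γ ℚ, ∀ x, |f x - polyFun p x| < ε := by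
  obtain ⟨p, hp⟩ := denseRange_polyFun.exists_dist_lt f hε
  exact ⟨p, fun x => (ContinuousMap.dist_apply_le_dist x).trans_lt hp⟩

/-- A continuous function on `2^Γ` depends on finitely many coordinates up to `ε`. -/
theorem exists_finset_abs_sub_le {Γ : Type*} (f : C(CantorCube Γ, ℝ)) {ε : ℝ} (hε : 0 < ε) :
    ∃ F : Finset Γ, ∀ x y : CantorCube Γ, (∀ γ ∈ F, x γ = y γ) → |f x - f y| ≤ ε := by
  obtain ⟨p, hp⟩ := exists_abs_sub_polyFun_lt f (half_pos hε)
  refine ⟨p.vars, fun x y hxy => ?_⟩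
  have hx := abs_lt.1 (hp x)
  have hy := abs_lt.1 (hp y)
  rw [polyFun_congr hxy] at hx
  exact abs_le.2 ⟨by linarith [hx.1, hy.2], by linarith [hx.2, hy.1]⟩

end CantorCube

/-! ### Separating sequences of maps into a countable type -/

/-- A sequence of maps `e n : Γ → Δ` is separating if every finite set is eventually mapped
injectively. -/
def IsSeparatingSeq {Γ Δ : Type*} (e : ℕ → Γ → Δ) : Prop :=
  ∀ F : Finset Γ, ∀ᶠ n in atTop, Set.InjOn (e n) F

/-- The `n`-th map sends `γ` to the restriction to `{0, …, n - 1}` of a set of natural numbers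
attached to `γ`. -/
theorem exists_isSeparatingSeq {Γ : Type u} (hΓ : #Γ < lift.{u} pseudoIntersectionNumber) :
    ∃ e : ℕ → Γ → Finset ℕ, IsSeparatingSeq e := by
  classical
  obtain ⟨r, hr⟩ := exists_injective_of_mk_lt hΓ
  refine ⟨fun n γ => (Finset.range n).filter (· ∈ r γ), fun F => ?_⟩
  have h : ∀ γ γ' : Γ, ∀ᶠ n in atTop, (Finset.range n).filter (· ∈ r γ) =
      (Finset.range n).filter (· ∈ r γ') → γ = γ' := by
    intro γ γ'
    by_cases hne : γ = γ'
    · exact Eventually.of_forall fun _ _ => hne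
    · have : ∃ k, ¬ (k ∈ r γ ↔ k ∈ r γ') := by
        by_contra! hcon
        exact hne (hr (Set.ext hcon))
      obtain ⟨k, hk⟩ := this
      filter_upwards [eventually_gt_atTop k] with n hn heq
      refine absurd ?_ hk
      simpa [hn] using Finset.ext_iff.1 heq k
  have := (F.eventually_all (l := atTop) (p := fun γ n => ∀ γ' ∈ F,
    (Finset.range n).filter (· ∈ r γ) = (Finset.range n).filter (· ∈ r γ') → γ = γ')).2
    fun γ _ => (F.eventually_all).2 fun γ' _ => h γ γ'
  filter_upwards [this] with n hn γ hγ γ' hγ' heq using hn γ hγ γ' hγ' heq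

/-- `2^Γ` is separable as soon as `Γ` has a separating sequence of maps into a countable type: the
points which factor through one of these maps and have finite support there are dense. -/
theorem exists_countable_dense_of_isSeparatingSeq {Γ Δ : Type*} [Countable Δ] {e : ℕ → Γ → Δ}
    (he : IsSeparatingSeq e) : ∃ A : Set (CantorCube Γ), A.Countable ∧ Dense A := by
  classical
  refine ⟨range fun c : ℕ × Finset Δ => fun γ => decide (e c.1 γ ∈ c.2), countable_range _, ?_⟩
  rw [dense_iff_inter_open]
  rintro V hV ⟨x, hx⟩
  obtain ⟨F, u, hu, hFV⟩ := isOpen_pi_iff.1 hV x hx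
  obtain ⟨n, hn⟩ := (he F).exists
  refine ⟨_, hFV fun γ hγ => ?_, ⟨(n, (F.filter (x · = true)).image (e n)), rfl⟩⟩
  convert (hu γ hγ).2 using 1
  rw [Bool.eq_iff_iff, decide_eq_true_iff, Finset.mem_image]
  constructor
  · rintro ⟨γ', hγ', h⟩
    rw [Finset.mem_filter] at hγ'
    rw [← hn hγ'.1 hγ h]
    exact hγ'.2
  · exact fun h => ⟨γ, Finset.mem_filter.2 ⟨hγ, h⟩, rfl⟩

/-! ### Open sets are measurable for the evaluations -/

namespace CantorCube

/-- The point of `2^Γ` which agrees with `z ∘ e` at the coordinates mapped into `L` by `e`, and with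
`x` at the others. -/
def overwrite {Γ Δ : Type*} [DecidableEq Δ] (e : Γ → Δ) (L : Finset Δ) (z : CantorCube Δ)
    (x : CantorCube Γ) : CantorCube Γ :=
  fun γ => if e γ ∈ L then z (e γ) else x γ

theorem continuous_overwrite {Γ Δ : Type*} [DecidableEq Δ] (e : Γ → Δ) (L : Finset Δ) :
    Continuous fun w : CantorCube Δ × CantorCube Γ => overwrite e L w.1 w.2 := by
  refine continuous_pi fun γ => ?_
  by_cases h : e γ ∈ L
  · simp only [overwrite, h, if_true]
    fun_prop
  · simp only [overwrite, h, if_false]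
    fun_prop

/-- The image of a rational polynomial in the coordinates of `2^Γ` under the `n`-th map of a
sequence `e n : Γ → Δ`, together with `n` and the image of its variables. For countable `Δ` there
are only countably many such codes. -/
noncomputable def code {Γ Δ : Type*} [DecidableEq Δ] (e : ℕ → Γ → Δ) (p : MvPolynomial Γ ℚ)
    (n : ℕ) : ℕ × Finset Δ × MvPolynomial Δ ℚ :=
  (n, p.vars.image (e n), MvPolynomial.rename (e n) p)

theorem code_injective {Γ Δ : Type*} [DecidableEq Δ] (e : ℕ → Γ → Δ) (p : MvPolynomial Γ ℚ) :
    Function.Injective (code e p) :=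
  fun _ _ h => congrArg Prod.fst h

/-- The functions `f` on `2^Γ` which are within `ε` of the polynomial of a code `(n, L, q)` at all
points that are constant on the fibres of `e n` over `L`. -/
def codeSet {Γ Δ : Type*} [DecidableEq Δ] (e : ℕ → Γ → Δ) (ε : ℝ)
    (c : ℕ × Finset Δ × MvPolynomial Δ ℚ) : Set C(CantorCube Γ, ℝ) :=
  {f | ∀ (z : CantorCube Δ) (x : CantorCube Γ),
    |f (overwrite (e c.1) c.2.1 z x) - polyFun c.2.2 z| ≤ ε}

theorem measurableSet_codeSet {Γ Δ : Type*} [DecidableEq Δ] [Countable Δ] {A : Set (CantorCube Γ)}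
    (hA : A.Countable) (hd : Dense A)
    (heval : ∀ x, Measurable[evalSigmaAlgebra A] fun f : C(CantorCube Γ, ℝ) => f x)
    (e : ℕ → Γ → Δ) (ε : ℝ) (c : ℕ × Finset Δ × MvPolynomial Δ ℚ) :
    MeasurableSet[evalSigmaAlgebra A] (codeSet e ε c) := by
  obtain ⟨Z, hZ, hZd⟩ := TopologicalSpace.exists_countable_dense (CantorCube Δ)
  have heq : codeSet e ε c = ⋂ w ∈ Z ×ˢ A,
      {f | |f (overwrite (e c.1) c.2.1 w.1 w.2) - polyFun c.2.2 w.1| ≤ ε} := by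
    ext f
    simp only [mem_iInter, mem_ofPred_eq]
    constructor
    · intro hf w _
      exact hf w.1 w.2
    · intro hf z x
      have hcl : IsClosed {w : CantorCube Δ × CantorCube Γ |
          |f (overwrite (e c.1) c.2.1 w.1 w.2) - polyFun c.2.2 w.1| ≤ ε} :=
        isClosed_le ((f.continuous.comp (continuous_overwrite _ _)).sub
          ((polyFun c.2.2).continuous.comp continuous_fst)).abs continuous_const
      exact hcl.closure_subset_iff.2 hf ((hZd.prod hd).closure_eq ▸ mem_univ (z, x))
  rw [heq]
  refine MeasurableSet.biInter (hZ.prod hA) fun w _ => ?_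
  have h1 : MeasurableSet {t : ℝ | |t - polyFun c.2.2 w.1| ≤ ε} :=
    measurableSet_le (by fun_prop) measurable_const
  exact heval (overwrite (e c.1) c.2.1 w.1 w.2) h1

theorem mem_codeSet_code {Γ Δ : Type*} [DecidableEq Δ] (e : ℕ → Γ → Δ) {ε : ℝ}
    {p : MvPolynomial Γ ℚ} {f : C(CantorCube Γ, ℝ)} (hf : ∀ x, |f x - polyFun p x| ≤ ε) (n : ℕ) :
    f ∈ codeSet e ε (code e p n) := by
  intro z x
  have h : polyFun (MvPolynomial.rename (e n) p) z =
      polyFun p (overwrite (e n) (p.vars.image (e n)) z x) := by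
    rw [polyFun_rename]
    refine polyFun_congr fun γ hγ => ?_
    simp only [overwrite, if_pos (Finset.mem_image_of_mem (e n) hγ), Function.comp]
  simp only [code, h]
  exact hf _

/-- Conversely to `mem_codeSet_code`, if `f` lies in the set of the `n`-th code of `p`, then `f` is
close to the polynomial, provided that the `n`-th map is injective on the variables together with a
finite set `F` of coordinates on which `f` depends up to `ε`: overwriting a point with its own
values at the variables then leaves its coordinates in `F` unchanged. -/
theorem abs_sub_polyFun_le {Γ Δ : Type*} [DecidableEq Γ] [DecidableEq Δ] {e : ℕ → Γ → Δ} {ε : ℝ}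
    {p : MvPolynomial Γ ℚ} {f : C(CantorCube Γ, ℝ)} {F : Finset Γ} {n : ℕ}
    (hF : ∀ x y : CantorCube Γ, (∀ γ ∈ F, x γ = y γ) → |f x - f y| ≤ ε)
    (hinj : Set.InjOn (e n) ↑(F ∪ p.vars)) (hf : f ∈ codeSet e ε (code e p n))
    (x : CantorCube Γ) : |f x - polyFun p x| ≤ 2 * ε := by
  let z : CantorCube Δ := fun l => decide (∃ γ ∈ p.vars, e n γ = l ∧ x γ = true)
  have hz : ∀ γ ∈ p.vars, z (e n γ) = x γ := by
    intro γ hγ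
    rw [Bool.eq_iff_iff, decide_eq_true_iff]
    constructor
    · rintro ⟨γ', hγ', h, hx⟩
      rwa [← hinj (by simp [hγ']) (by simp [hγ]) h]
    · exact fun hx => ⟨γ, hγ, rfl, hx⟩
  have h1 : |f x - f (overwrite (e n) (p.vars.image (e n)) z x)| ≤ ε := by
    refine hF _ _ fun γ hγ => ?_
    by_cases h : e n γ ∈ p.vars.image (e n)
    · obtain ⟨γ', hγ', heq⟩ := Finset.mem_image.1 h
      obtain rfl : γ' = γ := hinj (by simp [hγ']) (by simp [hγ]) heq
      simp only [overwrite, if_pos h, hz _ hγ']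
    · simp only [overwrite, if_neg h]
  have h2 := hf z x
  have h3 : polyFun (MvPolynomial.rename (e n) p) z = polyFun p x := by
    rw [polyFun_rename]
    exact polyFun_congr hz
  simp only [code, h3] at h2
  calc |f x - polyFun p x| ≤ _ := abs_sub_le _ (f (overwrite (e n) (p.vars.image (e n)) z x)) _
    _ ≤ 2 * ε := by linarith

theorem measurableSet_setOf_infinite {X Q : Type*} [Countable Q] [MeasurableSpace X] (S : Set Q)
    {P : Q → Set X} (hP : ∀ c, MeasurableSet (P c)) :
    MeasurableSet {f | {c ∈ S | f ∈ P c}.Infinite} := by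
  have : {f | {c ∈ S | f ∈ P c}.Infinite} = ⋂ t : Finset Q, ⋃ c ∈ S \ t, P c := by
    ext f
    simp only [mem_ofPred_eq, mem_iInter, mem_iUnion, exists_prop]
    constructor
    · intro h t
      obtain ⟨c, ⟨hcS, hc⟩, hct⟩ := (h.sdiff t.finite_toSet).nonempty
      exact ⟨c, ⟨hcS, hct⟩, hc⟩
    · intro h hfin
      obtain ⟨c, ⟨hcS, hct⟩, hc⟩ := h hfin.toFinset
      exact hct (by simpa using ⟨hcS, hc⟩)
  rw [this]
  exact MeasurableSet.iInter fun t => MeasurableSet.biUnion (to_countable _) fun c _ => hP c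

/-- Every set `U` has a subset `W`, measurable for the evaluations, which contains the centres of
all balls of radius `4ε` inside `U`. It consists of the `f` that lie in `codeSet e ε c` for
infinitely many `c ∈ S`, where `S` is a set of codes which contains infinitely many codes of each
polynomial whose `3ε`-ball lies in `U`, and, for each finite `F`, almost only codes of such
polynomials at levels where `F` and the variables are separated. -/
theorem exists_measurableSet_subset_of_ball_subset {Γ : Type u} [Infinite Γ] {Δ : Type}
    [Countable Δ] (hΓ : #Γ < lift.{u} pseudoIntersectionNumber) {e : ℕ → Γ → Δ}
    (he : IsSeparatingSeq e) {A : Set (CantorCube Γ)} (hA : A.Countable) (hd : Dense A)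
    (U : Set C(CantorCube Γ, ℝ)) {ε : ℝ} (hε : 0 < ε) :
    ∃ W : Set C(CantorCube Γ, ℝ), MeasurableSet[evalSigmaAlgebra A] W ∧ W ⊆ U ∧
      ∀ f, Metric.ball f (4 * ε) ⊆ U → f ∈ W := by
  classical
  let T : Set (MvPolynomial Γ ℚ) := {p | Metric.ball (polyFun p) (3 * ε) ⊆ U}
  have hinf : ℵ₀ < lift.{u} pseudoIntersectionNumber := (aleph0_le_mk Γ).trans_lt hΓ
  have hT : #T < lift.{u} pseudoIntersectionNumber := by
    refine (mk_set_le T).trans_lt (MvPolynomial.cardinalMk_le_max_lift.trans_lt ?_)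
    simp [hΓ]
  have hfs : #(Finset Γ) < lift.{u} pseudoIntersectionNumber := by rwa [mk_finset_of_infinite]
  have hΔ : Countable (MvPolynomial Δ ℚ) := by
    rw [← mk_le_aleph0_iff]
    refine MvPolynomial.cardinalMk_le_max.trans ?_
    simp
  let G : Finset Γ → Set (ℕ × Finset Δ × MvPolynomial Δ ℚ) := fun F =>
    {c | ∃ p ∈ T, ∃ n, Set.InjOn (e n) ↑(F ∪ p.vars) ∧ c = code e p n}
  obtain ⟨S, hSA, hSG⟩ := exists_infinite_inter_and_almost_subset hinf hT hfs
    (fun p : T => range (code e p.1)) G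
    (fun p => infinite_range_of_injective (code_injective e p.1)) (by
      intro p F
      have h := he (F ∪ p.1.vars)
      rw [← Nat.cofinite_eq_atTop, eventually_cofinite] at h
      refine (h.image (code e p.1)).subset ?_
      rintro _ ⟨⟨n, rfl⟩, hn⟩
      exact ⟨n, fun hinj => hn ⟨p.1, p.2, n, hinj, rfl⟩, rfl⟩)
  refine ⟨{f | {c ∈ S | f ∈ codeSet e ε c}.Infinite},
    @measurableSet_setOf_infinite _ _ _ (evalSigmaAlgebra A) _ _ fun c =>
      measurableSet_codeSet hA hd (measurable_eval hΓ hA hd) e ε c, ?_, ?_⟩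
  · intro f hf
    obtain ⟨F, hF⟩ := exists_finset_abs_sub_le f hε
    obtain ⟨c, ⟨hcS, hfc⟩, hc⟩ := (Set.Infinite.sdiff hf (hSG F)).nonempty
    have hcG : c ∈ G F := by
      by_contra h
      exact hc ⟨hcS, h⟩
    obtain ⟨p, hp, n, hinj, rfl⟩ := hcG
    refine hp (Metric.mem_ball.2 (((ContinuousMap.dist_le (by positivity)).2 fun x =>
      abs_sub_polyFun_le hF hinj hfc x).trans_lt (by linarith)))
  · intro f hf
    obtain ⟨p, hp⟩ := exists_abs_sub_polyFun_lt f hε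
    have hpT : p ∈ T := by
      refine (Metric.ball_subset_ball' ?_).trans hf
      have : dist (polyFun p) f ≤ ε := (ContinuousMap.dist_le hε.le).2 fun x => by
        rw [dist_comm]
        exact (hp x).le
      linarith
    refine (hSA ⟨p, hpT⟩).mono ?_
    rintro _ ⟨hcS, n, rfl⟩
    exact ⟨hcS, mem_codeSet_code e (fun x => (hp x).le) n⟩

/-- The Borel σ-algebra of `C(2^Γ)` is generated by the evaluations at any countable dense set, for
every infinite `Γ` of cardinality less than `𝔭`. -/
theorem borel_eq_evalSigmaAlgebra {Γ : Type u} [Infinite Γ]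
    (hΓ : #Γ < lift.{u} pseudoIntersectionNumber) {A : Set (CantorCube Γ)} (hA : A.Countable)
    (hd : Dense A) : borel C(CantorCube Γ, ℝ) = evalSigmaAlgebra A := by
  refine le_antisymm (MeasurableSpace.generateFrom_le fun U hU => ?_) (evalSigmaAlgebra_le_borel A)
  obtain ⟨e, he⟩ := exists_isSeparatingSeq hΓ
  choose W hWm hWU hW using fun k : ℕ =>
    exists_measurableSet_subset_of_ball_subset hΓ he hA hd U (ε := 1 / ((k : ℝ) + 1))
      (by positivity)
  have hUW : U = ⋃ k, W k := by
    refine subset_antisymm (fun f hf => ?_) (iUnion_subset hWU)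
    obtain ⟨δ, hδ, hball⟩ := Metric.isOpen_iff.1 (show IsOpen U from hU) f hf
    obtain ⟨k, hk⟩ := exists_nat_one_div_lt (show 0 < δ / 4 by positivity)
    exact mem_iUnion.2 ⟨k, hW k f ((Metric.ball_subset_ball (by linarith)).trans hball)⟩
  rw [hUW]
  exact MeasurableSet.iUnion hWm

end CantorCube

theorem mainTheorem11 (hp : ℵ₁ < pseudoIntersectionNumber) :
    @MeasurableSpace.CountablyGenerated C(CantorCube (Iio (ω₁ : Ordinal.{0})), ℝ) (borel _) ∧
    (∃ A : Set (CantorCube (Iio (ω₁ : Ordinal.{0}))), A.Countable ∧ Dense A) ∧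
    ∀ A : Set (CantorCube (Iio (ω₁ : Ordinal.{0}))), A.Countable → Dense A →
      borel C(CantorCube (Iio (ω₁ : Ordinal.{0})), ℝ) = evalSigmaAlgebra A := by
  have hmk : #(Iio (ω₁ : Ordinal.{0})) = ℵ₁ := by simp
  have hΓ : #(Iio (ω₁ : Ordinal.{0})) < Cardinal.lift.{1} pseudoIntersectionNumber := by
    rw [hmk]
    simpa using Cardinal.lift_lt.{0, 1}.2 hp
  have : Infinite (Iio (ω₁ : Ordinal.{0})) := by
    rw [infinite_iff, hmk]
    exact aleph0_le_aleph 1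
  obtain ⟨e, he⟩ := exists_isSeparatingSeq hΓ
  obtain ⟨A, hA, hd⟩ := exists_countable_dense_of_isSeparatingSeq he
  refine ⟨?_, ⟨A, hA, hd⟩, fun B hB hBd => CantorCube.borel_eq_evalSigmaAlgebra hΓ hB hBd⟩
  rw [CantorCube.borel_eq_evalSigmaAlgebra hΓ hA hd]
  exact countablyGenerated_evalSigmaAlgebra hA
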